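/- Consider a market with a finite set $I$ of unit-demand buyers and a finite set $J$ of goods. The utility of buyer $i$ for receiving good $j$ at price $x$ is $u_i^j(x)$, where $u_i^j:\mathbb{R}\to\mathbb{R}$ is continuous, strictly decreasing, and zero or negative for all large enough $x$; an unmatched buyer has payoff $0$. A *competitive equilibrium* is a price vector $\mathbf{p}\in\mathbb{R}^J$ and a payoff vector $\mathbf{u}\in\mathbb{R}^I$ with $\mathbf{p}\ge 0$, $\mathbf{u}\ge 0$ for which there is a matching $\mu$ of buyers to goods (a *supporting matching*; each buyer gets at most one good and each good goes to at most one buyer) such that $\mathbf{u}_i=u_i^j(\mathbf{p}^j)$ if $i$ is matched to $j$ and $\mathbf{u}_i\ge u_i^j(\mathbf{p}^j)$ otherwise, $\mathbf{u}_i=0$ for every unmatched buyer $i$, and $\mathbf{p}^j=0$ for every unmatched good $j$. The *lowest* competitive equilibrium is the one whose price vector is componentwise at most that of every competitive equilibrium. **Theorem (Group Strategyproofness).** Every such market has a lowest competitive equilibrium, so there is a mechanism that asks all buyers to report their utility functions and outputs the prices of the lowest competitive equilibrium of the reported market together with an allocation given by a supporting matching of it. Every such mechanism is group strategyproof for buyers: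 for all true utility functions, there are no nonempty coalition $S\subseteq I$ and misreport of the utility functions $u_i^j$, $i\in S$, $j\in J$ (by functions of the above kind, the buyers outside $S$ reporting truthfully), such that every member of $S$ gets a strictly higher payoff, measured by her true utility functions and without side payments, than when all buyers report truthfully. -/

import Mathlib

namespace MatchingMarket

/-- The utility of one buyer for one good as a function of the price of that good: continuous,
strictly decreasing, and zero or negative at every large enough price. -/
structure Utility where
  toFun : ℝ → ℝ
  continuous_toFun : Continuous toFun
  strictAnti_toFun : StrictAnti toFun
  exists_nonpos : ∃ x, toFun x ≤ 0

instance : CoeFun Utility (fun _ => ℝ → ℝ) := ⟨Utility.toFun⟩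

/-- A market with buyers `I` and goods `J`: `M i j x` is the utility of buyer `i` for receiving
good `j` at price `x`. -/
abbrev Market (I J : Type*) := I → J → Utility

/-- The matching `μ` supports the price vector `p` and the payoff vector `u` as a competitive
equilibrium of `M`. A matching is a partial bijection: `μ i = some j` (equivalently
`μ.symm j = some i`) if buyer `i` receives good `j`, and `none` stands for being unmatched. -/
structure Supports {I J : Type*} (M : Market I J) (p : J → ℝ) (u : I → ℝ) (μ : I ≃. J) :
    Prop where
  payoff_eq : ∀ i j, μ i = some j → u i = M i j (p j)
  payoff_ge : ∀ i j, μ i ≠ some j → M i j (p j) ≤ u i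
  payoff_unmatched : ∀ i, μ i = none → u i = 0
  price_unmatched : ∀ j, μ.symm j = none → p j = 0
  payoff_nonneg : ∀ i, 0 ≤ u i
  price_nonneg : ∀ j, 0 ≤ p j

/-- `(p, u)` is a competitive equilibrium of `M`: it has a supporting matching. -/
def IsCompetitiveEquilibrium {I J : Type*} (M : Market I J) (p : J → ℝ) (u : I → ℝ) : Prop :=
  ∃ μ : I ≃. J, Supports M p u μ

/-- `(p, u)` is the lowest competitive equilibrium of `M`: its price vector is componentwise at
most that of any competitive equilibrium of `M`. -/
def IsLowestCompetitiveEquilibrium {I J : Type*} (M : Market I J) (p : J → ℝ) (u : I → ℝ) :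
    Prop :=
  IsCompetitiveEquilibrium M p u ∧ ∀ p' u', IsCompetitiveEquilibrium M p' u' → p ≤ p'

/-- What a mechanism outputs: prices of the goods and an allocation of goods to buyers. -/
structure Outcome (I J : Type*) where
  price : J → ℝ
  allocation : I ≃. J

/-- The payoff that buyer `i`, whose utility functions are `v`, gets from the outcome `o`: the
utility of the received good at its price, and `0` without a good. -/
def Outcome.payoff {I J : Type*} (o : Outcome I J) (v : J → Utility) (i : I) : ℝ :=
  match o.allocation i with
  | some j => v j (o.price j)
  | none => 0

/-- A (direct) mechanism maps the reported utility functions to an outcome. -/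
abbrev Mechanism (I J : Type*) := Market I J → Outcome I J

/-- The mechanism outputs, for all reports, the prices of the lowest competitive equilibrium of
the reported market and an allocation supporting that equilibrium. -/
def Mechanism.SelectsLowestCE {I J : Type*} (F : Mechanism I J) : Prop :=
  ∀ M : Market I J, ∃ u : I → ℝ,
    IsLowestCompetitiveEquilibrium M (F M).price u ∧ Supports M (F M).price u (F M).allocation

/-- Group strategyproofness for buyers: whatever the true utilities `M`, no nonempty coalition `S`
can change the reports of its members (giving `M'`) so that each member gets a strictly higher
true payoff. -/
def Mechanism.GroupStrategyproof {I J : Type*} (F : Mechanism I J) : Prop :=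
  ∀ (M M' : Market I J) (S : Set I), S.Nonempty → (∀ i, i ∉ S → M' i = M i) →
    ¬ ∀ i ∈ S, (F M).payoff (M i) i < (F M').payoff (M i) i

end MatchingMarket

/-! Existence: an ascending auction with increment ε ends in an approximate equilibrium, and
compactness lets ε tend to 0. Two equilibria merge into one by taking the lower price of each good
(`Supports.inf`), so an equilibrium minimising the sum of prices is the lowest.

Strategyproofness: suppose a misreport helps a coalition. Let A be all buyers who truly gain and T
the goods they then receive. Each good in T is cheaper than under truthful reports, so its truthful
price is positive. Buyers outside A report truthfully and do not gain, so they strictly prefer their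
truthful payoffs to T at truthful prices. Hence the truthful equilibrium sells T to A, and by
counting it matches A with T exactly. Outsiders do not compete for this block, so its prices can
fall (`Supports.exists_not_le`): set reserve prices slightly below the truthful ones; since buyers
do not outnumber goods in the block, it has an equilibrium with some good at its reserve. This
contradicts lowestness. -/

namespace MatchingMarket

/-! ### Matchings -/

/-- A partial assignment of goods that never uses a good twice is a matching. -/
theorem exists_matching_eq {I J : Type*} (f : I → Option J)
    (hf : ∀ i i' j, f i = some j → f i' = some j → i = i') :
    ∃ μ : I ≃. J, ∀ i, μ i = f i := by
  classical
  refine ⟨⟨f, fun j => if h : ∃ i, f i = some j then some h.choose else none, ?_⟩, fun _ => rfl⟩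
  intro i j
  by_cases h : ∃ i, f i = some j
  · simp only [dif_pos h, Option.some.injEq]
    exact ⟨fun e => e ▸ h.choose_spec, fun e => hf _ _ _ h.choose_spec e⟩
  · simp only [dif_neg h, reduceCtorEq, false_iff]
    exact fun e => h ⟨i, e⟩

theorem matching_injective {I J : Type*} (μ : I ≃. J) {i i' : I} {j : J}
    (h : μ i = some j) (h' : μ i' = some j) : i = i' :=
  μ.inj h h'

theorem symm_eq_none_iff {I J : Type*} (μ : I ≃. J) (j : J) :
    μ.symm j = none ↔ ∀ i, μ i ≠ some j := by
  rw [Option.eq_none_iff_forall_ne_some]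
  exact forall_congr' fun i => not_congr (PEquiv.eq_some_iff μ)

/-- If `μ` sends all of `A` into `T` and all of `T` receives `ν`-partners from `A`, then both
matchings restrict to bijections between `A` and `T`. -/
theorem matched_of_matched {I J : Type*} [Finite I] {A : Set I} {T : Set J} (μ ν : I ≃. J)
    (hμ : ∀ i ∈ A, ∃ j ∈ T, μ i = some j) (hν : ∀ j ∈ T, ∃ i ∈ A, ν i = some j) :
    (∀ i ∈ A, ∃ j ∈ T, ν i = some j) ∧ ∀ j ∈ T, ∃ i ∈ A, μ i = some j := by
  choose f hfT hf using hμ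
  choose g hgA hg using hν
  let F : A → T := fun i => ⟨f i i.2, hfT i i.2⟩
  let G : T → A := fun j => ⟨g j j.2, hgA j j.2⟩
  have hF : Function.Injective F := by
    intro a b hab
    have h1 := hf a a.2
    have h2 := hf b b.2
    rw [show f a a.2 = f b b.2 from congrArg Subtype.val hab] at h1
    exact Subtype.ext (matching_injective μ h1 h2)
  have hG : Function.Injective G := by
    intro a b hab
    have h1 := hg a a.2
    have h2 := hg b b.2
    rw [show g a a.2 = g b b.2 from congrArg Subtype.val hab, h2] at h1
    exact Subtype.ext (Option.some.inj h1).symm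
  have hGF : Function.Surjective (G ∘ F) := Finite.surjective_of_injective (hG.comp hF)
  refine ⟨fun i hi => ?_, fun j hj => ?_⟩
  · obtain ⟨a, ha⟩ := hGF ⟨i, hi⟩
    refine ⟨F a, (F a).2, ?_⟩
    have := hg (F a) (F a).2
    rwa [show g (F a) (F a).2 = i from congrArg Subtype.val ha] at this
  · obtain ⟨a, ha⟩ := hGF (G ⟨j, hj⟩)
    refine ⟨a, a.2, ?_⟩
    have := hf a a.2
    rwa [show f a a.2 = j from congrArg Subtype.val (hG ha)] at this

/-! ### Approximate and exact equilibria -/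

/-- Prices `p` and a matching `μ` at which all demands are met when every buyer believes that
switching to another good costs an increment `ε` on top of its price. -/
structure ApproxSupports {I J : Type*} (M : Market I J) (ε : ℝ) (p : J → ℝ) (μ : I ≃. J) :
    Prop where
  nonneg_of_matched : ∀ i j, μ i = some j → 0 ≤ M i j (p j)
  best_of_matched : ∀ i j, μ i = some j → ∀ j', M i j' (p j' + ε) ≤ M i j (p j)
  nonpos_of_unmatched : ∀ i, μ i = none → ∀ j, M i j (p j + ε) ≤ 0
  price_unmatched : ∀ j, μ.symm j = none → p j = 0
  price_nonneg : ∀ j, 0 ≤ p j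

theorem Supports.utility_le {I J : Type*} {M : Market I J} {p : J → ℝ} {u : I → ℝ} {μ : I ≃. J}
    (h : Supports M p u μ) (i : I) (j : J) : M i j (p j) ≤ u i := by
  by_cases e : μ i = some j
  · exact (h.payoff_eq i j e).ge
  · exact h.payoff_ge i j e

/-- Prices and matching determine the payoffs, so the limit argument can run on prices alone. -/
theorem approxSupports_zero_iff {I J : Type*} {M : Market I J} {p : J → ℝ} {μ : I ≃. J} :
    ApproxSupports M 0 p μ ↔ ∃ u, Supports M p u μ := by
  constructor
  · intro h
    refine ⟨fun i => (μ i).elim 0 fun j => M i j (p j), ⟨?_, ?_, ?_, h.price_unmatched, ?_,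
      h.price_nonneg⟩⟩
    · intro i j hij; simp [hij]
    · intro i j _
      rcases hi : μ i with _ | j'
      · simpa using h.nonpos_of_unmatched i hi j
      · simpa using h.best_of_matched i j' hi j
    · intro i hi; simp [hi]
    · intro i
      rcases hi : μ i with _ | j'
      · simp
      · simpa using h.nonneg_of_matched i j' hi
  · rintro ⟨u, h⟩
    refine ⟨fun i j e => ?_, fun i j e j' => ?_, fun i e j => ?_, h.price_unmatched,
      h.price_nonneg⟩
    · rw [← h.payoff_eq i j e]; exact h.payoff_nonneg i
    · rw [← h.payoff_eq i j e, add_zero]; exact h.utility_le i j'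
    · rw [add_zero, ← h.payoff_unmatched i e]; exact h.utility_le i j

theorem Supports.exists_of_payoff_pos {I J : Type*} {M : Market I J} {p : J → ℝ} {u : I → ℝ}
    {μ : I ≃. J} (h : Supports M p u μ) {i : I} (hi : 0 < u i) : ∃ j, μ i = some j := by
  rcases e : μ i with _ | j
  · exact absurd (h.payoff_unmatched i e) hi.ne'
  · exact ⟨j, rfl⟩

theorem Supports.exists_of_price_pos {I J : Type*} {M : Market I J} {p : J → ℝ} {u : I → ℝ}
    {μ : I ≃. J} (h : Supports M p u μ) {j : J} (hj : 0 < p j) : ∃ i, μ i = some j := by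
  by_contra! hne
  exact hj.ne' (h.price_unmatched j ((symm_eq_none_iff μ j).2 hne))

theorem Utility.lt_iff (v : Utility) {x y : ℝ} : v x < v y ↔ y < x :=
  v.strictAnti_toFun.lt_iff_gt

theorem Utility.le_iff (v : Utility) {x y : ℝ} : v x ≤ v y ↔ y ≤ x :=
  v.strictAnti_toFun.le_iff_ge

/-- No buyer pays more than a common bound for a good that gives her a nonnegative payoff. -/
theorem exists_price_bound {I J : Type*} [Finite I] [Finite J] (M : Market I J) :
    ∃ B : ℝ, 0 ≤ B ∧ ∀ i j x, 0 ≤ M i j x → x ≤ B := by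
  choose x hx using fun ij : I × J => (M ij.1 ij.2).exists_nonpos
  obtain ⟨B, hB⟩ := Finite.exists_le x
  refine ⟨max B 0, le_max_right _ _, fun i j y hy => ?_⟩
  have : M i j (x (i, j)) ≤ M i j y := (hx (i, j)).trans hy
  exact ((M i j).le_iff.1 this).trans ((hB (i, j)).trans (le_max_left _ _))

theorem ApproxSupports.price_le {I J : Type*} {M : Market I J} {ε B : ℝ} {p : J → ℝ} {μ : I ≃. J}
    (h : ApproxSupports M ε p μ) (hB₀ : 0 ≤ B) (hB : ∀ i j x, 0 ≤ M i j x → x ≤ B) (j : J) :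
    p j ≤ B := by
  by_cases hj : ∃ i, μ i = some j
  · obtain ⟨i, hi⟩ := hj
    exact hB i j _ (h.nonneg_of_matched i j hi)
  · push Not at hj
    rw [h.price_unmatched j ((symm_eq_none_iff μ j).2 hj)]
    exact hB₀

/-! ### The ascending auction -/

/-- A state of the ascending auction with increment `ε`: `k j` counts the bids on good `j`, so
that the asking price of `j` is `ε * k j`, and the last bidder on `j` holds it at the price
`ε * (k j - 1)`. As long as goods are not scarce, some good has had at most one bid. -/
structure AuctionState {I J : Type*} (M : Market I J) (ε : ℝ) (k : J → ℕ) (μ : I ≃. J) :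
    Prop where
  bid_pos : ∀ i j, μ i = some j → 1 ≤ k j
  nonneg_of_matched : ∀ i j, μ i = some j → 0 ≤ M i j (ε * (k j - 1 : ℕ))
  best_of_matched : ∀ i j, μ i = some j → ∀ j', M i j' (ε * k j') ≤ M i j (ε * (k j - 1 : ℕ))
  bid_unmatched : ∀ j, (∀ i, μ i ≠ some j) → k j = 0
  exists_bid_le_one : Nat.card I ≤ Nat.card J → Nonempty J → ∃ j, k j ≤ 1

theorem exists_unmatched_good {I J : Type*} [Finite I] [Finite J] (μ : I ≃. J)
    (hc : Nat.card I ≤ Nat.card J) {i : I} (hi : μ i = none) : ∃ j, ∀ i, μ i ≠ some j := by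
  by_contra! h
  choose g hg using h
  have hinj : Function.Injective g := fun a b hab =>
    Option.some.inj ((hg a).symm.trans ((congrArg μ hab).trans (hg b)))
  have hbij : Function.Bijective g := (Nat.bijective_iff_injective_and_card g).2
    ⟨hinj, le_antisymm (Nat.card_le_card_of_injective g hinj) hc⟩
  obtain ⟨j, rfl⟩ := hbij.2 i
  simp [hg] at hi

/-- The unmatched buyer bids on her best good at asking prices and displaces its holder. Asking
prices only rise, so the other holders still prefer what they hold. -/
theorem AuctionState.exists_next {I J : Type*} [Finite I] [Fintype J] {M : Market I J} {ε : ℝ}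
    (hε : 0 < ε) {k : J → ℕ} {μ : I ≃. J} (h : AuctionState M ε k μ)
    {i : I} (hi : μ i = none) {j₀ : J} (hj₀ : 0 < M i j₀ (ε * k j₀)) :
    ∃ (k' : J → ℕ) (μ' : I ≃. J), AuctionState M ε k' μ' ∧ ∑ j, k' j = ∑ j, k j + 1 := by
  classical
  have : Nonempty J := ⟨j₀⟩
  obtain ⟨j, hj⟩ := Finite.exists_max fun j => M i j (ε * k j)
  have hpos : 0 < M i j (ε * k j) := hj₀.trans_le (hj j₀)
  obtain ⟨ν, hν⟩ := exists_matching_eq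
    (fun x => if x = i then some j else if μ x = some j then none else μ x) (by
      intro a b y ha hb
      split_ifs at ha hb with h1 h2 h3 h4 h5
      · rw [h1, h2]
      · exact absurd (hb.trans ha.symm) h3
      · exact absurd (ha.trans hb.symm) h4
      · exact matching_injective μ ha hb)
  set k' : J → ℕ := Function.update k j (k j + 1) with hk'
  have hkj : k' j = k j + 1 := by simp [hk']
  have hky : ∀ y, y ≠ j → k' y = k y := fun y hy => by simp [hk', hy]
  have hle : ∀ y, k y ≤ k' y := fun y => by
    by_cases e : y = j
    · subst e; omega
    · rw [hky y e]
  have hanti : ∀ x y, M x y (ε * k' y) ≤ M x y (ε * k y) := fun x y => by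
    rw [Utility.le_iff]
    have := hle y
    gcongr
  have hνi : ν i = some j := by simp [hν]
  have hother : ∀ x y, x ≠ i → ν x = some y → y ≠ j ∧ μ x = some y := by
    intro x y hx hxy
    simp only [hν, hx, if_false] at hxy
    split_ifs at hxy with h1
    exact ⟨fun e => h1 (e ▸ hxy), hxy⟩
  refine ⟨k', ν, ⟨?_, ?_, ?_, ?_, ?_⟩, ?_⟩
  · intro x y hxy
    by_cases hx : x = i
    · obtain rfl : j = y := by rw [hx, hνi] at hxy; exact Option.some.inj hxy
      omega
    · obtain ⟨_, h2⟩ := hother x y hx hxy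
      exact (h.bid_pos x y h2).trans (hle y)
  · intro x y hxy
    by_cases hx : x = i
    · subst hx
      obtain rfl : j = y := by rw [hνi] at hxy; exact Option.some.inj hxy
      rw [hkj]
      exact hpos.le
    · obtain ⟨h1, h2⟩ := hother x y hx hxy
      rw [hky y h1]
      exact h.nonneg_of_matched x y h2
  · intro x y hxy z
    refine (hanti x z).trans ?_
    by_cases hx : x = i
    · subst hx
      obtain rfl : j = y := by rw [hνi] at hxy; exact Option.some.inj hxy
      rw [hkj]
      exact hj z
    · obtain ⟨h1, h2⟩ := hother x y hx hxy
      rw [hky y h1]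
      exact h.best_of_matched x y h2 z
  · intro y hy
    have hyj : y ≠ j := fun e => hy i (e ▸ hνi)
    rw [hky y hyj]
    refine h.bid_unmatched y fun x hx => hy x ?_
    have hxi : x ≠ i := fun e => by rw [e, hi] at hx; cases hx
    rw [hν, if_neg hxi, if_neg (by rw [hx]; exact fun e => hyj (Option.some.inj e)), hx]
  · intro hc _
    -- Before this bid buyer `i` was unmatched, so some good had no bid at all; now it has at most
    -- one.
    obtain ⟨y, hy⟩ := exists_unmatched_good μ hc hi
    refine ⟨y, ?_⟩
    have h0 := h.bid_unmatched y hy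
    by_cases e : y = j
    · subst e; omega
    · rw [hky y e]; omega
  · rw [hk', Finset.sum_update_of_mem (Finset.mem_univ j),
      ← Finset.add_sum_erase _ k (Finset.mem_univ j), Finset.sdiff_singleton_eq_erase]
    omega

/-- Each bid raises the total count by one, while the common price bound caps the count of every
good, so bidding must stop. -/
theorem exists_final_auctionState {I J : Type*} [Finite I] [Finite J] (M : Market I J) {ε : ℝ}
    (hε : 0 < ε) : ∃ (k : J → ℕ) (μ : I ≃. J), AuctionState M ε k μ ∧
      ∀ i, μ i = none → ∀ j, M i j (ε * k j) ≤ 0 := by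
  classical
  have := Fintype.ofFinite J
  by_contra! hne
  have hall : ∀ n : ℕ, ∃ (k : J → ℕ) (μ : I ≃. J), AuctionState M ε k μ ∧ ∑ j, k j = n := by
    intro n
    induction n with
    | zero =>
      refine ⟨fun _ => 0, ⊥, ⟨?_, ?_, ?_, fun _ _ => rfl, ?_⟩, by simp⟩
      · intro i j h; cases h
      · intro i j h; cases h
      · intro i j h; cases h
      · rintro _ ⟨j⟩; exact ⟨j, zero_le_one⟩
    | succ n ih =>
      obtain ⟨k, μ, h, hn⟩ := ih
      obtain ⟨i, hi, j, hj⟩ := hne k μ h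
      obtain ⟨k', μ', h', hs⟩ := h.exists_next hε hi hj
      exact ⟨k', μ', h', by rw [hs, hn]⟩
  obtain ⟨B, hB₀, hB⟩ := exists_price_bound M
  obtain ⟨N, hN⟩ := exists_nat_gt (B / ε)
  obtain ⟨k, μ, h, hs⟩ := hall (Fintype.card J * (N + 1) + 1)
  have hk : ∀ j, k j ≤ N + 1 := by
    intro j
    by_cases hj : ∃ i, μ i = some j
    · obtain ⟨i, hi⟩ := hj
      have h1 := hB i j _ (h.nonneg_of_matched i j hi)
      have h2 : ((k j - 1 : ℕ) : ℝ) < N := by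
        refine lt_of_le_of_lt ?_ hN
        rw [le_div_iff₀ hε]
        linarith
      have h3 : k j - 1 < N := by exact_mod_cast h2
      omega
    · push Not at hj
      rw [h.bid_unmatched j hj]
      omega
  have : ∑ j, k j ≤ Fintype.card J * (N + 1) := by
    simpa using Finset.sum_le_card_nsmul Finset.univ k (N + 1) fun j _ => hk j
  omega

theorem exists_approxSupports {I J : Type*} [Finite I] [Finite J] (M : Market I J) {ε : ℝ}
    (hε : 0 < ε) : ∃ (p : J → ℝ) (μ : I ≃. J), ApproxSupports M ε p μ ∧
      (Nat.card I ≤ Nat.card J → Nonempty J → ∃ j, p j = 0) := by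
  obtain ⟨k, μ, h, hf⟩ := exists_final_auctionState M hε
  -- Price plus `ε` is the asking price, except for a good without bids, where truncated subtraction
  -- makes it larger.
  have hanti : ∀ i j, M i j (ε * (k j - 1 : ℕ) + ε) ≤ M i j (ε * k j) := fun i j => by
    rw [Utility.le_iff]
    have : ((k j : ℕ) : ℝ) ≤ (k j - 1 : ℕ) + 1 := by
      exact_mod_cast (by omega : k j ≤ k j - 1 + 1)
    nlinarith
  refine ⟨fun j => ε * (k j - 1 : ℕ), μ, ⟨h.nonneg_of_matched, ?_, ?_, ?_, ?_⟩, ?_⟩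
  · intro i j hij j'
    exact (hanti i j').trans (h.best_of_matched i j hij j')
  · intro i hi j
    exact (hanti i j).trans (hf i hi j)
  · intro j hj
    simp [h.bid_unmatched j ((symm_eq_none_iff μ j).1 hj)]
  · intro j
    positivity
  · intro hc hJ
    obtain ⟨j, hj⟩ := h.exists_bid_le_one hc hJ
    exact ⟨j, by simp [Nat.sub_eq_zero_of_le hj]⟩

/-! ### Letting the increment tend to zero -/

theorem isClosed_approxSupports {I J : Type*} (M : Market I J) (μ : I ≃. J) :
    IsClosed {x : ℝ × (J → ℝ) | ApproxSupports M x.1 x.2 μ} := by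
  have hc : ∀ i j, Continuous (M i j).toFun := fun i j => (M i j).continuous_toFun
  have : {x : ℝ × (J → ℝ) | ApproxSupports M x.1 x.2 μ} =
      {x | ∀ i j, μ i = some j → 0 ≤ M i j (x.2 j)} ∩
      {x | ∀ i j, μ i = some j → ∀ j', M i j' (x.2 j' + x.1) ≤ M i j (x.2 j)} ∩
      {x | ∀ i, μ i = none → ∀ j, M i j (x.2 j + x.1) ≤ 0} ∩
      {x | ∀ j, μ.symm j = none → x.2 j = 0} ∩ {x | ∀ j, 0 ≤ x.2 j} := by
    ext x
    exact ⟨fun h => ⟨⟨⟨⟨h.1, h.2⟩, h.3⟩, h.4⟩, h.5⟩, fun h => ⟨h.1.1.1.1, h.1.1.1.2, h.1.1.2,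
      h.1.2, h.2⟩⟩
  rw [this]
  simp only [Set.ofPred_forall]
  refine (((IsClosed.inter ?_ ?_).inter ?_).inter ?_).inter ?_
  · exact isClosed_iInter fun i => isClosed_iInter fun j => isClosed_iInter fun _ =>
      isClosed_le (by fun_prop) ((hc i j).comp (by fun_prop))
  · exact isClosed_iInter fun i => isClosed_iInter fun j => isClosed_iInter fun _ =>
      isClosed_iInter fun j' =>
      isClosed_le ((hc i j').comp (by fun_prop)) ((hc i j).comp (by fun_prop))
  · exact isClosed_iInter fun i => isClosed_iInter fun _ => isClosed_iInter fun j =>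
      isClosed_le ((hc i j).comp (by fun_prop)) (by fun_prop)
  · exact isClosed_iInter fun j => isClosed_iInter fun _ =>
      isClosed_eq (by fun_prop) (by fun_prop)
  · exact isClosed_iInter fun j => isClosed_le (by fun_prop) (by fun_prop)

instance finite_matching {I J : Type*} [Finite I] [Finite J] : Finite (I ≃. J) :=
  Finite.of_injective (fun μ : I ≃. J => (μ : I → Option J)) DFunLike.coe_injective

/-- The approximate equilibria whose increments lie in `[0, 1]` form a compact set. -/
theorem isCompact_approxSupports {I J : Type*} [Finite I] [Finite J] (M : Market I J) :
    IsCompact {x : ℝ × (J → ℝ) | x.1 ∈ Set.Icc 0 1 ∧ ∃ μ, ApproxSupports M x.1 x.2 μ} := by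
  obtain ⟨B, hB₀, hB⟩ := exists_price_bound M
  refine IsCompact.of_isClosed_subset ((isCompact_Icc : IsCompact (Set.Icc (0 : ℝ) 1)).prod
    (isCompact_Icc : IsCompact (Set.Icc (0 : J → ℝ) fun _ => B))) ?_ ?_
  · refine IsClosed.inter (isClosed_Icc.preimage continuous_fst) ?_
    change IsClosed {x : ℝ × (J → ℝ) | ∃ μ, ApproxSupports M x.1 x.2 μ}
    rw [Set.ofPred_exists]
    exact isClosed_iUnion_of_finite fun μ => isClosed_approxSupports M μ
  · rintro ⟨ε, p⟩ ⟨hε, μ, h⟩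
    exact ⟨hε, h.price_nonneg, h.price_le hB₀ hB⟩

/-- Competitive equilibria exist and, unless there are more buyers than goods, there is one at
which some good is free. -/
theorem exists_competitiveEquilibrium {I J : Type*} [Finite I] [Finite J] (M : Market I J) :
    ∃ p u, IsCompetitiveEquilibrium M p u ∧
      (Nat.card I ≤ Nat.card J → Nonempty J → ∃ j, p j = 0) := by
  let Z : Set (ℝ × (J → ℝ)) := {x | Nat.card I ≤ Nat.card J → Nonempty J → ∃ j, x.2 j = 0}
  have hZ : IsClosed Z := by
    by_cases hc : Nat.card I ≤ Nat.card J ∧ Nonempty J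
    · have : Z = ⋃ j, {x | x.2 j = 0} := by
        ext x
        simp [Z, hc.1, hc.2]
      rw [this]
      exact isClosed_iUnion_of_finite fun j => isClosed_eq (by fun_prop) (by fun_prop)
    · have : Z = Set.univ := Set.eq_univ_of_forall fun x h1 h2 => absurd ⟨h1, h2⟩ hc
      rw [this]
      exact isClosed_univ
  -- The realised increments form a closed set containing (0, 1), hence 0.
  have hK := (((isCompact_approxSupports M).inter_right hZ).image continuous_fst).isClosed
  have h0 : (0 : ℝ) ∈ closure (Set.Ioo (0 : ℝ) 1) := by
    rw [closure_Ioo zero_ne_one]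
    simp
  have hsub := closure_minimal (s := Set.Ioo (0 : ℝ) 1) (fun ε hε => by
    obtain ⟨p, μ, h, hz⟩ := exists_approxSupports M hε.1
    exact ⟨(ε, p), ⟨⟨Set.Ioo_subset_Icc_self hε, μ, h⟩, hz⟩, rfl⟩) hK
  obtain ⟨⟨ε, p⟩, ⟨⟨_, μ, h⟩, hz⟩, rfl⟩ := hsub h0
  obtain ⟨u, hu⟩ := approxSupports_zero_iff.1 h
  exact ⟨p, u, ⟨μ, hu⟩, hz⟩

/-! ### Meets of equilibria and the lowest equilibrium -/

/-- The componentwise lower prices of two competitive equilibria are equilibrium prices, supported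
by a matching that leaves out only what `μ'` leaves out. -/
theorem Supports.inf {I J : Type*} [Finite I] {M : Market I J} {p p' : J → ℝ}
    {u u' : I → ℝ} {μ μ' : I ≃. J} (h : Supports M p u μ) (h' : Supports M p' u' μ') :
    ∃ ν, Supports M (p ⊓ p') (u ⊔ u') ν ∧ (∀ i, ν i = none → μ' i = none) ∧
      ∀ j, ν.symm j = none → μ'.symm j = none := by
  classical
  -- Under `μ`, buyers in `A` hold only goods in `T`; under `μ'`, goods in `T` go only to `A`. So
  -- both match `A` with `T`, and `μ` on `A` can be glued to `μ'` elsewhere.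
  let A : Set I := {i | u' i < u i}
  let T : Set J := {j | p j < p' j}
  have hA : ∀ i ∈ A, ∃ j ∈ T, μ i = some j := by
    intro i (hi : u' i < u i)
    obtain ⟨j, hj⟩ := h.exists_of_payoff_pos ((h'.payoff_nonneg i).trans_lt hi)
    refine ⟨j, ?_, hj⟩
    rw [h.payoff_eq i j hj] at hi
    exact (M i j).lt_iff.1 ((h'.utility_le i j).trans_lt hi)
  have hT : ∀ j ∈ T, ∃ i ∈ A, μ' i = some j := by
    intro j (hj : p j < p' j)
    obtain ⟨i, hi⟩ := h'.exists_of_price_pos ((h.price_nonneg j).trans_lt hj)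
    refine ⟨i, ?_, hi⟩
    change u' i < u i
    rw [h'.payoff_eq i j hi]
    exact ((M i j).lt_iff.2 hj).trans_le (h.utility_le i j)
  obtain ⟨hA', hT'⟩ := matched_of_matched μ μ' hA hT
  have hμT : ∀ i ∉ A, ∀ j, μ' i = some j → j ∉ T := by
    intro i hi j hij hj
    obtain ⟨i', hi', e⟩ := hT j hj
    exact hi (matching_injective μ' hij e ▸ hi')
  have hμT' : ∀ i ∈ A, ∀ j, μ i = some j → j ∈ T := by
    intro i hi j hij
    obtain ⟨j', hj', e⟩ := hA i hi
    rw [hij] at e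
    exact Option.some.inj e ▸ hj'
  obtain ⟨ν, hν⟩ := exists_matching_eq (fun i => if i ∈ A then μ i else μ' i) (by
    intro a b j ha hb
    by_cases h1 : a ∈ A <;> by_cases h2 : b ∈ A <;>
      simp only [h1, h2, if_true, if_false] at ha hb
    · exact matching_injective μ ha hb
    · exact absurd (hμT' a h1 j ha) (hμT b h2 j hb)
    · exact absurd (hμT' b h2 j hb) (hμT a h1 j ha)
    · exact matching_injective μ' ha hb)
  have hνnone : ∀ i, ν i = none → i ∉ A ∧ μ' i = none := by
    intro i hi
    by_cases hiA : i ∈ A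
    · obtain ⟨j, _, e⟩ := hA i hiA
      simp [hν, hiA, e] at hi
    · exact ⟨hiA, by simpa [hν, hiA] using hi⟩
  have hνsymm : ∀ j, ν.symm j = none → j ∉ T ∧ μ'.symm j = none := by
    intro j hj
    rw [symm_eq_none_iff] at hj ⊢
    have hjT : j ∉ T := fun hjT => by
      obtain ⟨i, hi, e⟩ := hT' j hjT
      exact hj i (by simp [hν, hi, e])
    refine ⟨hjT, fun i hi => ?_⟩
    by_cases hiA : i ∈ A
    · obtain ⟨j', hj', e⟩ := hA' i hiA
      rw [hi] at e
      exact hjT (Option.some.inj e ▸ hj')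
    · exact hj i (by simp [hν, hiA, hi])
  refine ⟨ν, ⟨?_, ?_, ?_, ?_, ?_, ?_⟩, fun i hi => (hνnone i hi).2, fun j hj => (hνsymm j hj).2⟩
  · intro i j hij
    by_cases hi : i ∈ A
    · have hij' : μ i = some j := by simpa [hν, hi] using hij
      have hj : p j < p' j := hμT' i hi j hij'
      have hi' : u' i < u i := hi
      rw [Pi.sup_apply, Pi.inf_apply, sup_eq_left.2 hi'.le, inf_eq_left.2 hj.le]
      exact h.payoff_eq i j hij'
    · have hij' : μ' i = some j := by simpa [hν, hi] using hij
      have hj : p' j ≤ p j := not_lt.1 (hμT i hi j hij')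
      have hi' : u i ≤ u' i := not_lt.1 hi
      rw [Pi.sup_apply, Pi.inf_apply, sup_eq_right.2 hi', inf_eq_right.2 hj]
      exact h'.payoff_eq i j hij'
  · intro i j _
    rw [Pi.sup_apply, Pi.inf_apply]
    rcases min_cases (p j) (p' j) with ⟨e, _⟩ | ⟨e, _⟩ <;> rw [e]
    · exact le_sup_of_le_left (h.utility_le i j)
    · exact le_sup_of_le_right (h'.utility_le i j)
  · intro i hi
    obtain ⟨h1, h2⟩ := hνnone i hi
    rw [Pi.sup_apply, sup_eq_right.2 (not_lt.1 h1)]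
    exact h'.payoff_unmatched i h2
  · intro j hj
    obtain ⟨h1, h2⟩ := hνsymm j hj
    rw [Pi.inf_apply, inf_eq_right.2 (not_lt.1 h1)]
    exact h'.price_unmatched j h2
  · exact fun i => le_sup_of_le_left (h.payoff_nonneg i)
  · exact fun j => le_inf (h.price_nonneg j) (h'.price_nonneg j)

/-- Every market has a lowest competitive equilibrium. -/
theorem exists_isLowestCompetitiveEquilibrium {I J : Type*} [Finite I] [Finite J]
    (M : Market I J) : ∃ p u, IsLowestCompetitiveEquilibrium M p u := by
  have := Fintype.ofFinite J
  let K : Set (ℝ × (J → ℝ)) := {x | x.1 ∈ Set.Icc 0 1 ∧ ∃ μ, ApproxSupports M x.1 x.2 μ}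
  have hK : IsCompact (K ∩ {x | x.1 = 0}) :=
    (isCompact_approxSupports M).inter_right (isClosed_eq continuous_fst continuous_const)
  have hmem : ∀ {p u}, IsCompetitiveEquilibrium M p u → ((0 : ℝ), p) ∈ K ∩ {x | x.1 = 0} := by
    rintro p u ⟨μ, h⟩
    exact ⟨⟨⟨le_rfl, zero_le_one⟩, μ, approxSupports_zero_iff.2 ⟨u, h⟩⟩, rfl⟩
  obtain ⟨p₀, u₀, h₀, _⟩ := exists_competitiveEquilibrium M
  obtain ⟨⟨ε, p⟩, ⟨⟨_, μ, h⟩, he⟩, hmin⟩ := hK.exists_isMinOn ⟨_, hmem h₀⟩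
    (f := fun x : ℝ × (J → ℝ) => ∑ j, x.2 j) (by fun_prop)
  obtain rfl : ε = 0 := he
  obtain ⟨u, hu⟩ := approxSupports_zero_iff.1 h
  refine ⟨p, u, ⟨μ, hu⟩, ?_⟩
  rintro p' u' ⟨μ', h'⟩
  obtain ⟨ν, hν, _⟩ := hu.inf h'
  -- The meet is again an equilibrium, so minimality of the sum forces it to equal `p`.
  have hs : ∑ j, p j ≤ ∑ j, (p ⊓ p') j := isMinOn_iff.1 hmin _ (hmem ⟨ν, hν⟩)
  have heq := (Finset.sum_eq_sum_iff_of_le fun j _ => (inf_le_left : (p ⊓ p') j ≤ p j)).1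
    (le_antisymm (Finset.sum_le_sum fun j _ => (inf_le_left : (p ⊓ p') j ≤ p j)) hs)
  intro j
  exact inf_eq_left.1 (heq j (Finset.mem_univ j))

/-! ### Lowering prices on an isolated block -/

/-- The utility function after a shift of the price by `r`. -/
def Utility.shift (v : Utility) (r : ℝ) : Utility where
  toFun x := v (x + r)
  continuous_toFun := v.continuous_toFun.comp (by fun_prop)
  strictAnti_toFun _ _ h := v.strictAnti_toFun (by simpa using h)
  exists_nonpos := by
    obtain ⟨x, hx⟩ := v.exists_nonpos
    exact ⟨x - r, by simpa using hx⟩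

/-- If the buyers in `A` receive exactly the goods in `T`, and outsiders strictly prefer their
payoffs to these positively priced goods, then some of the goods in `T` can be made cheaper. -/
theorem Supports.exists_not_le {I J : Type*} [Finite I] [Finite J] {M : Market I J} {p : J → ℝ}
    {u : I → ℝ} {μ : I ≃. J} (h : Supports M p u μ) {A : Set I} {T : Set J} (hne : T.Nonempty)
    (hA : ∀ i ∈ A, ∃ j ∈ T, μ i = some j) (hT : ∀ j ∈ T, ∃ i ∈ A, μ i = some j)
    (hpos : ∀ j ∈ T, 0 < p j) (hout : ∀ i ∉ A, ∀ j ∈ T, M i j (p j) < u i) :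
    ∃ p' u', IsCompetitiveEquilibrium M p' u' ∧ ¬ p ≤ p' := by
  classical
  -- Reserve prices: below `p`, yet by continuity still unattractive to outsiders.
  have hr : ∀ j : T, ∃ r : ℝ, 0 ≤ r ∧ r < p j ∧ ∀ i ∉ A, M i j r ≤ u i := by
    intro j
    have h1 : ∀ᶠ x in nhdsWithin (p j) (Set.Iio (p j)), 0 < x :=
      nhdsWithin_le_nhds (lt_mem_nhds (hpos j j.2))
    have h2 : ∀ᶠ x in nhdsWithin (p j) (Set.Iio (p j)), ∀ i, i ∉ A → M i j x < u i := by
      rw [Filter.eventually_all]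
      intro i
      by_cases hi : i ∈ A
      · simp [hi]
      · have := (M i j).continuous_toFun.continuousAt.eventually_lt_const (hout i hi j j.2)
        filter_upwards [nhdsWithin_le_nhds this] with x hx _ using hx
    obtain ⟨x, ⟨hx1, hx2⟩, hx3⟩ := ((h1.and h2).and self_mem_nhdsWithin).exists
    exact ⟨x, hx1.le, hx3, fun i hi => (hx2 i hi).le⟩
  choose r hr0 hrp hrout using hr
  -- Prices in `N` are the excess over the reserves.
  let N : Market A T := fun i j => (M i j).shift (r j)
  have hN : ∀ (i : A) (j : T) x, N i j x = M i j (x + r j) := fun i j x => rfl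
  obtain ⟨μ₀, hμ₀⟩ : ∃ μ₀ : A ≃. T, ∀ i j, μ₀ i = some j ↔ μ i = some (j : J) := by
    choose f hfT hf using hA
    obtain ⟨μ₀, hμ₀⟩ := exists_matching_eq
      (fun i : A => some (⟨f i i.2, hfT i i.2⟩ : T)) (by
        intro a b j ha hb
        have e : f a a.2 = f b b.2 := congrArg Subtype.val (Option.some.inj (ha.trans hb.symm))
        exact Subtype.ext (matching_injective μ (hf a a.2) (e ▸ hf b b.2)))
    refine ⟨μ₀, fun i j => ?_⟩
    rw [hμ₀, hf i i.2, Option.some.injEq, Option.some.injEq, Subtype.ext_iff]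
  have hμ₀A : ∀ i, μ₀ i ≠ none := by
    intro i hi
    obtain ⟨j, hj, e⟩ := hA i i.2
    rw [(hμ₀ i ⟨j, hj⟩).2 e] at hi
    cases hi
  have hμ₀T : ∀ j, μ₀.symm j ≠ none := by
    intro j hj
    obtain ⟨i, hi, e⟩ := hT j j.2
    exact (symm_eq_none_iff μ₀ j).1 hj ⟨i, hi⟩ ((hμ₀ _ _).2 e)
  have h₀ : Supports N (fun j => p j - r j) (fun i => u i) μ₀ := by
    refine ⟨?_, ?_, fun i hi => absurd hi (hμ₀A i), fun j hj => absurd hj (hμ₀T j),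
      fun i => h.payoff_nonneg i, fun j => sub_nonneg.2 (hrp j).le⟩
    · intro i j hij
      rw [hN, sub_add_cancel]
      exact h.payoff_eq i j ((hμ₀ i j).1 hij)
    · intro i j _
      rw [hN, sub_add_cancel]
      exact h.utility_le i j
  have hcard : Nat.card A ≤ Nat.card T := by
    choose f hf using fun i : A => Option.ne_none_iff_exists'.1 (hμ₀A i)
    refine Nat.card_le_card_of_injective f fun a b hab => ?_
    exact matching_injective μ₀ (hf a) (hab ▸ hf b)
  obtain ⟨q, w, ⟨κ, hq⟩, hz⟩ := exists_competitiveEquilibrium N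
  obtain ⟨j₀, hj₀⟩ := hz hcard hne.to_subtype
  -- The meet with the old equilibrium keeps prices at most `p`, so no block buyer is tempted by
  -- goods outside `T`. With `μ₀` in second place, all of `A` and `T` stay matched.
  obtain ⟨ν, hν, hνA, hνT⟩ := hq.inf h₀
  set m : T → ℝ := q ⊓ fun j => p j - r j
  set w' : A → ℝ := w ⊔ fun i => u i
  have hνsome : ∀ i, ∃ j, ν i = some j := fun i =>
    Option.ne_none_iff_exists'.1 fun e => hμ₀A i (hνA i e)
  have hmle : ∀ j, m j + r j ≤ p j := fun j => by
    have : m j ≤ p j - r j := inf_le_right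
    linarith
  have hmT : ∀ i ∉ A, ∀ j, μ i = some j → j ∉ T := by
    intro i hi j hij hj
    obtain ⟨i', hi', e⟩ := hT j hj
    exact hi (matching_injective μ hij e ▸ hi')
  let p' : J → ℝ := fun j => if hj : j ∈ T then m ⟨j, hj⟩ + r ⟨j, hj⟩ else p j
  let u' : I → ℝ := fun i => if hi : i ∈ A then w' ⟨i, hi⟩ else u i
  have hp'T : ∀ j (hj : j ∈ T), p' j = m ⟨j, hj⟩ + r ⟨j, hj⟩ := fun j hj => dif_pos hj
  have hp'T' : ∀ j, j ∉ T → p' j = p j := fun j hj => dif_neg hj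
  have hu'A : ∀ i (hi : i ∈ A), u' i = w' ⟨i, hi⟩ := fun i hi => dif_pos hi
  have hu'A' : ∀ i, i ∉ A → u' i = u i := fun i hi => dif_neg hi
  have hu'ge : ∀ i, u i ≤ u' i := fun i => by
    by_cases hi : i ∈ A
    · rw [hu'A i hi]
      exact le_sup_right
    · rw [hu'A' i hi]
  let f : I → Option J := fun i =>
    if hi : i ∈ A then (ν ⟨i, hi⟩).map Subtype.val else μ i
  have hfA : ∀ i (hi : i ∈ A) (j : J), f i = some j ↔ ∃ hj : j ∈ T, ν ⟨i, hi⟩ = some ⟨j, hj⟩ := by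
    intro i hi j
    simp only [f, dif_pos hi, Option.map_eq_some_iff]
    constructor
    · rintro ⟨a, ha, rfl⟩
      exact ⟨a.2, ha⟩
    · rintro ⟨hj, e⟩
      exact ⟨_, e, rfl⟩
  have hfA' : ∀ i, i ∉ A → f i = μ i := fun i hi => dif_neg hi
  obtain ⟨η, hη⟩ := exists_matching_eq f (by
    intro a b j ha hb
    by_cases h1 : a ∈ A <;> by_cases h2 : b ∈ A
    · obtain ⟨hj, e1⟩ := (hfA a h1 j).1 ha
      obtain ⟨_, e2⟩ := (hfA b h2 j).1 hb
      exact congrArg Subtype.val (matching_injective ν e1 e2)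
    · obtain ⟨hj, _⟩ := (hfA a h1 j).1 ha
      rw [hfA' b h2] at hb
      exact absurd hj (hmT b h2 j hb)
    · obtain ⟨hj, _⟩ := (hfA b h2 j).1 hb
      rw [hfA' a h1] at ha
      exact absurd hj (hmT a h1 j ha)
    · rw [hfA' a h1] at ha
      rw [hfA' b h2] at hb
      exact matching_injective μ ha hb)
  refine ⟨p', u', ⟨η, ?_, ?_, ?_, ?_, ?_, ?_⟩, ?_⟩
  · intro i j hij
    rw [hη] at hij
    by_cases hi : i ∈ A
    · obtain ⟨hj, e⟩ := (hfA i hi j).1 hij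
      rw [hu'A i hi, hp'T j hj, hν.payoff_eq _ _ e, hN]
    · rw [hfA' i hi] at hij
      rw [hu'A' i hi, hp'T' j (hmT i hi j hij)]
      exact h.payoff_eq i j hij
  · intro i j _
    by_cases hj : j ∈ T
    · rw [hp'T j hj]
      by_cases hi : i ∈ A
      · rw [hu'A i hi]
        exact hν.utility_le ⟨i, hi⟩ ⟨j, hj⟩
      · rw [hu'A' i hi]
        refine le_trans ?_ (hrout ⟨j, hj⟩ i hi)
        rw [Utility.le_iff]
        have := hν.price_nonneg ⟨j, hj⟩
        linarith
    · rw [hp'T' j hj]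
      exact (h.utility_le i j).trans (hu'ge i)
  · intro i hi
    rw [hη] at hi
    by_cases hiA : i ∈ A
    · obtain ⟨j, e⟩ := hνsome ⟨i, hiA⟩
      rw [(hfA i hiA j).2 ⟨j.2, e⟩] at hi
      cases hi
    · rw [hfA' i hiA] at hi
      rw [hu'A' i hiA]
      exact h.payoff_unmatched i hi
  · intro j hj
    rw [symm_eq_none_iff] at hj
    have hjT : j ∉ T := fun hjT => by
      refine hμ₀T ⟨j, hjT⟩ (hνT _ ((symm_eq_none_iff ν _).2 fun i e => hj i ?_))
      rw [hη, hfA i i.2]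
      exact ⟨hjT, e⟩
    rw [hp'T' j hjT]
    refine h.price_unmatched j ((symm_eq_none_iff μ j).2 fun i hi => ?_)
    by_cases hiA : i ∈ A
    · obtain ⟨j', hj', e⟩ := hA i hiA
      rw [hi] at e
      exact hjT (Option.some.inj e ▸ hj')
    · exact hj i (by rw [hη, hfA' i hiA, hi])
  · exact fun i => (h.payoff_nonneg i).trans (hu'ge i)
  · intro j
    by_cases hj : j ∈ T
    · rw [hp'T j hj]
      exact add_nonneg (hν.price_nonneg _) (hr0 _)
    · rw [hp'T' j hj]
      exact h.price_nonneg j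
  · intro hle
    have h1 := hle j₀
    rw [hp'T j₀ j₀.2] at h1
    have h2 : m j₀ ≤ q j₀ := inf_le_left
    have h3 := hrp j₀
    change p j₀ ≤ m j₀ + r j₀ at h1
    linarith

/-! ### Mechanisms and group strategyproofness -/

theorem Supports.payoff_outcome {I J : Type*} {M : Market I J} {o : Outcome I J} {u : I → ℝ}
    (h : Supports M o.price u o.allocation) (i : I) : o.payoff (M i) i = u i := by
  rcases e : o.allocation i with _ | j
  · simp [Outcome.payoff, e, h.payoff_unmatched i e]
  · simp [Outcome.payoff, e, h.payoff_eq i j e]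

theorem exists_selectsLowestCE {I J : Type*} [Finite I] [Finite J] :
    ∃ F : Mechanism I J, F.SelectsLowestCE := by
  have h : ∀ M : Market I J, ∃ o : Outcome I J, ∃ u : I → ℝ,
      IsLowestCompetitiveEquilibrium M o.price u ∧ Supports M o.price u o.allocation := by
    intro M
    obtain ⟨p, u, hl⟩ := exists_isLowestCompetitiveEquilibrium M
    obtain ⟨μ, hμ⟩ := hl.1
    exact ⟨⟨p, μ⟩, u, hl, hμ⟩
  choose F hF using h
  exact ⟨F, hF⟩

theorem Mechanism.SelectsLowestCE.groupStrategyproof {I J : Type*} [Finite I] [Finite J]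
    {F : Mechanism I J} (hF : F.SelectsLowestCE) : F.GroupStrategyproof := by
  intro M M' S hS hout hgain
  obtain ⟨u, ⟨_, hlow⟩, h⟩ := hF M
  obtain ⟨u', _, h'⟩ := hF M'
  set p := (F M).price
  set p' := (F M').price
  set μ := (F M).allocation
  set μ' := (F M').allocation
  let v : I → ℝ := fun i => (F M').payoff (M i) i
  -- All gainers, not only `S`: every buyer outside `A` is then both truthful and no better off.
  let A : Set I := {i | u i < v i}
  let T : Set J := {j | ∃ i ∈ A, μ' i = some j}
  have hSA : ∀ i ∈ S, i ∈ A := by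
    intro i hi
    have := hgain i hi
    rwa [h.payoff_outcome i] at this
  have hvA : ∀ i ∉ A, ∀ j, M i j (p' j) ≤ u i := by
    intro i hi j
    have hM : M' i = M i := hout i fun hiS => hi (hSA i hiS)
    have hv : v i = u' i := by rw [← h'.payoff_outcome i, hM]
    rw [← hM]
    exact (h'.utility_le i j).trans (hv ▸ not_lt.1 hi)
  have hA' : ∀ i ∈ A, ∃ j ∈ T, μ' i = some j := by
    intro i hi
    rcases e : μ' i with _ | j
    · have hv : v i = 0 := by simp only [v, Outcome.payoff]; rw [e]
      exact absurd (h.payoff_nonneg i) (not_le.2 (hv ▸ hi))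
    · exact ⟨j, ⟨i, hi, e⟩, rfl⟩
  have hlt : ∀ j ∈ T, p' j < p j := by
    rintro j ⟨i, hi, e⟩
    have hv : v i = M i j (p' j) := by simp only [v, Outcome.payoff]; rw [e]
    have hi' : u i < v i := hi
    rw [hv] at hi'
    exact (M i j).lt_iff.1 ((h.utility_le i j).trans_lt hi')
  have hpos : ∀ j ∈ T, 0 < p j := fun j hj => (h'.price_nonneg j).trans_lt (hlt j hj)
  have hsep : ∀ i ∉ A, ∀ j ∈ T, M i j (p j) < u i := fun i hi j hj =>
    ((M i j).lt_iff.2 (hlt j hj)).trans_le (hvA i hi j)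
  have hT : ∀ j ∈ T, ∃ i ∈ A, μ i = some j := by
    intro j hj
    obtain ⟨i, hi⟩ := h.exists_of_price_pos (hpos j hj)
    refine ⟨i, ?_, hi⟩
    by_contra hiA
    exact (hsep i hiA j hj).ne (h.payoff_eq i j hi).symm
  have hne : T.Nonempty := by
    obtain ⟨i, hi⟩ := hS
    obtain ⟨j, hj, _⟩ := hA' i (hSA i hi)
    exact ⟨j, hj⟩
  obtain ⟨p₁, u₁, h₁, hn⟩ :=
    h.exists_not_le hne (matched_of_matched μ' μ hA' hT).1 hT hpos hsep
  exact hn (hlow p₁ u₁ h₁)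

end MatchingMarket

theorem mainTheorem2 {I J : Type*} [Finite I] [Finite J] :
    (∃ F : MatchingMarket.Mechanism I J, F.SelectsLowestCE) ∧
      ∀ F : MatchingMarket.Mechanism I J, F.SelectsLowestCE → F.GroupStrategyproof :=
  ⟨MatchingMarket.exists_selectsLowestCE, fun _ hF => hF.groupStrategyproof⟩
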